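/- Let $K$ be an integral domain and let $\nu$ be an index set. For a matrix $A=(a_{kl})_{k,l\in\nu}$ over $K$, the support of $A$ is the smallest subset $\nu'\subseteq\nu$ such that $A$ coincides with the identity matrix outside $\nu'\times\nu'$. Let $FL_\nu(K)$ be the group, under matrix multiplication, of all invertible matrices of degree $\nu$ over $K$ with finite support (the finitary linear group of degree $\nu$ over $K$). Then every torsion subgroup $G$ of $FL_\nu(K)$ is locally finite, that is, every finitely generated subgroup of $G$ is finite. Moreover, if $\nu$ is countable (finite or countably infinite), then there are subgroups $G_1\le G_2\le\cdots$ of $G$ with $G=\bigcup_{i\ge 1}G_i$, and subgroups $N_i\le G_i$ $(i\ge 1)$, such that (i) for each $i$, $N_i$ is a nilpotent normal subgroup of $G_i$ and $G_i/N_i$ is countable (possibly finite); (ii) the product $\prod_{i=1}^{\infty}N_i=\bigcup_{i\ge1}N_1N_2\cdots N_i$, i.e. the set of all finite ordered products $n_1n_2\cdots n_i$ with $i\ge 1$ and $n_j\in N_j$, is a subgroup of $G$; (iii) for each $i$, $N_1N_2\cdots N_i$ is a subgroup in which $N_i$ is normal, and the quotient group $N_1N_2\cdots N_i/N_i$ is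 countable (possibly finite). -/

import Mathlib

open scoped Pointwise

/-- The support of a matrix `A` of degree `ν`: the indices `k` such that the `k`-th row or the
`k`-th column of `A` differs from that of the identity matrix. It is the smallest set `S` such
that `A` coincides with the identity matrix outside `S × S` (`matSupp_isLeast`). -/
def matSupp {ν K : Type*} [Ring K] (A : Matrix ν ν K) : Set ν :=
  open Classical in
  {k | ∃ j, A k j ≠ (if k = j then 1 else 0) ∨ A j k ≠ (if j = k then 1 else 0)}

open Classical in
theorem matSupp_eq_one {ν K : Type*} [Ring K] {A : Matrix ν ν K} {i j : ν}
    (h : ¬ (i ∈ matSupp A ∧ j ∈ matSupp A)) : A i j = if i = j then 1 else 0 := by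
  by_contra hne
  exact h ⟨⟨j, Or.inl hne⟩, ⟨i, Or.inr hne⟩⟩

open Classical in
theorem matSupp_subset {ν K : Type*} [Ring K] {A : Matrix ν ν K} {S : Set ν}
    (h : ∀ i j, ¬ (i ∈ S ∧ j ∈ S) → A i j = if i = j then 1 else 0) : matSupp A ⊆ S := by
  rintro k ⟨j, hj | hj⟩
  · by_contra hk
    exact hj (h k j fun h' => hk h'.1)
  · by_contra hk
    exact hj (h j k fun h' => hk h'.2)

open Classical in
theorem matSupp_isLeast {ν K : Type*} [Ring K] (A : Matrix ν ν K) :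
    IsLeast {S : Set ν | ∀ i j, ¬ (i ∈ S ∧ j ∈ S) → A i j = if i = j then 1 else 0}
      (matSupp A) :=
  ⟨fun _ _ h => matSupp_eq_one h, fun _ hS => matSupp_subset hS⟩

/-- The product of matrices of degree `ν`; for matrices with finite support all the sums have
only finitely many nonzero terms. -/
noncomputable def matMul {ν K : Type*} [Ring K] (A B : Matrix ν ν K) : Matrix ν ν K :=
  fun i j => ∑ᶠ k, A i k * B k j

theorem matMul_eq_sum {ν K : Type*} [Ring K] {A : Matrix ν ν K} (B : Matrix ν ν K) {i : ν} (j : ν)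
    {T : Finset ν} (hA : matSupp A ⊆ T) (hi : i ∈ T) :
    matMul A B i j = ∑ k ∈ T, A i k * B k j := by
  classical
  refine finsum_eq_sum_of_support_subset _ fun k hk => ?_
  by_contra hkT
  apply hk
  have : A i k = if i = k then 1 else 0 := matSupp_eq_one fun h => hkT (hA h.2)
  have hik : i ≠ k := fun h => hkT (h ▸ hi)
  simp [this, hik]

theorem matSupp_matMul {ν K : Type*} [Ring K] {A B : Matrix ν ν K}
    (hA : (matSupp A).Finite) : matSupp (matMul A B) ⊆ matSupp A ∪ matSupp B := by
  classical
  refine matSupp_subset fun i j hij => ?_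
  have hA' : matSupp A ⊆ (insert i hA.toFinset : Finset ν) := by
    intro k hk; simp [hk]
  rw [matMul_eq_sum B j hA' (Finset.mem_insert_self _ _)]
  by_cases hi : i ∈ matSupp A ∪ matSupp B
  · have hj : j ∉ matSupp A ∪ matSupp B := fun hj => hij ⟨hi, hj⟩
    have hB : ∀ k, B k j = if k = j then 1 else 0 := fun k =>
      matSupp_eq_one fun h => hj (Or.inr h.2)
    have hAj : A i j = if i = j then 1 else 0 := matSupp_eq_one fun h => hj (Or.inl h.2)
    have hne : i ≠ j := fun h => hj (h ▸ hi)
    simp [hB, hAj, hne]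
  · have hAi : ∀ k, A i k = if i = k then 1 else 0 := fun k =>
      matSupp_eq_one fun h => hi (Or.inl h.1)
    have hBi : B i j = if i = j then 1 else 0 := matSupp_eq_one fun h => hi (Or.inr h.1)
    simp [hAi, hBi]

theorem matMul_assoc {ν K : Type*} [Ring K] {A B C : Matrix ν ν K}
    (hA : (matSupp A).Finite) (hB : (matSupp B).Finite) :
    matMul (matMul A B) C = matMul A (matMul B C) := by
  classical
  funext i j
  let T : Finset ν := insert i (hA.toFinset ∪ hB.toFinset)
  have hAT : matSupp A ⊆ T := by intro k hk; simp [T, hk]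
  have hBT : matSupp B ⊆ T := by intro k hk; simp [T, hk]
  have hiT : i ∈ T := Finset.mem_insert_self _ _
  rw [matMul_eq_sum C j ((matSupp_matMul hA).trans (Set.union_subset hAT hBT)) hiT,
    matMul_eq_sum _ j hAT hiT]
  have h1 : ∀ k ∈ T, matMul A B i k * C k j = ∑ l ∈ T, A i l * B l k * C k j := fun k _ => by
    rw [matMul_eq_sum B k hAT hiT, Finset.sum_mul]
  have h2 : ∀ l ∈ T, A i l * matMul B C l j = ∑ k ∈ T, A i l * B l k * C k j := fun l hl => by
    rw [matMul_eq_sum C j hBT hl, Finset.mul_sum]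
    simp only [mul_assoc]
  rw [Finset.sum_congr rfl h1, Finset.sum_congr rfl h2, Finset.sum_comm]

/-- Finitary matrices of degree `ν` over `K`: the matrices with finite support. -/
structure FinitaryMatrix (ν K : Type*) [Ring K] where
  entry : Matrix ν ν K
  finite_supp : (matSupp entry).Finite

theorem FinitaryMatrix.ext' {ν K : Type*} [Ring K] {A B : FinitaryMatrix ν K}
    (h : A.entry = B.entry) : A = B := by
  cases A
  cases B
  cases h
  rfl

open Classical in
/-- Finitary matrices form a monoid under matrix multiplication, with the identity matrix as
neutral element. -/
noncomputable instance FinitaryMatrix.instMonoid {ν K : Type*} [Ring K] :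
    Monoid (FinitaryMatrix ν K) where
  mul A B := ⟨matMul A.entry B.entry,
    (A.finite_supp.union B.finite_supp).subset (matSupp_matMul A.finite_supp)⟩
  one := ⟨fun i j => if i = j then 1 else 0,
    Set.finite_empty.subset (matSupp_subset fun _ _ _ => rfl)⟩
  mul_assoc A B _ := FinitaryMatrix.ext' (matMul_assoc A.finite_supp B.finite_supp)
  one_mul A := FinitaryMatrix.ext' <| by
    funext i j
    change ∑ᶠ k, (if i = k then (1 : K) else 0) * A.entry k j = A.entry i j
    rw [finsum_eq_single _ i fun k hk => by simp [Ne.symm hk]]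
    simp
  mul_one A := FinitaryMatrix.ext' <| by
    funext i j
    change ∑ᶠ k, A.entry i k * (if k = j then (1 : K) else 0) = A.entry i j
    rw [finsum_eq_single _ j fun k hk => by simp [hk]]
    simp

/-- The finitary linear group `FL_ν(K)`: the group of all invertible finitary matrices of
degree `ν` over `K`. -/
abbrev FL (ν K : Type*) [Ring K] : Type _ := (FinitaryMatrix ν K)ˣ

/-- A group is locally finite if each of its finitely generated subgroups is finite. -/
def IsLocallyFiniteGroup (G : Type*) [Group G] : Prop :=
  ∀ H : Subgroup G, H.FG → Finite H

/-- For subgroups `N 0, N 1, …` of a group, the set `N 0 * N 1 * ⋯ * N i` of all products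
`n₀ * n₁ * ⋯ * nᵢ` with `nⱼ ∈ N j`. -/
def partialProd {Γ : Type*} [Group Γ] (N : ℕ → Subgroup Γ) : ℕ → Set Γ
  | 0 => N 0
  | i + 1 => partialProd N i * (N (i + 1) : Set Γ)

/-- The infinite product of the subgroups `N 0, N 1, …`: the set of all finite ordered products
`n₀ * n₁ * ⋯ * nᵢ` with `nⱼ ∈ N j`. -/
def infiniteProd {Γ : Type*} [Group Γ] (N : ℕ → Subgroup Γ) : Set Γ :=
  ⋃ i, partialProd N i

/-- `N` is a normal subgroup of `H`, where both are subgroups of a group `Γ`. -/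
def IsNormalIn {Γ : Type*} [Group Γ] (N H : Subgroup Γ) : Prop :=
  N ≤ H ∧ (N.subgroupOf H).Normal

/-!
Everything reduces to torsion matrix groups of finite degree over an algebraically closed field
`F` containing `K`: finitely many finitary matrices and their inverses are supported in a finite
set `S`, and restriction to `S × S` is a faithful representation (`restrictHom_injective`).

*Local finiteness* is Schur's theorem (`finite_of_fg_torsion_linear`). The entries of a finitely
generated matrix group lie in a domain `R` that is finitely generated over `ℤ`, so reduction modulo
a maximal ideal `m` of `R` has a finite image, hence a kernel of finite index. If `A ≡ 1` modulo `m`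
and `A ^ N = 1` with `N ∉ m`, then `A = 1`, because `1 + A + ⋯ + A ^ (N - 1) ≡ N` has a nonzero
determinant; so the torsion elements of the kernel have `p`-power order, where `p` is the
characteristic of `R / m`.
In characteristic zero, adjoining `1 / p` to `R` gives a second prime `q ≠ p`, and the intersection
of the two kernels is trivial. In characteristic `p` the kernel is a `p`-group, and every linear
`p`-group in characteristic `p` is nilpotent (`IsPGroup.isNilpotent_of_linear`); a finitely
generated solvable torsion group is finite.

*Nilpotency of linear `p`-groups* in characteristic `p`: it suffices that the products
`(u₁ - 1) ⋯ (uₙ - 1)` vanish, where `n` is the degree. This property only involves finitely many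
elements, and it can be checked modulo the maximal ideals of a finitely generated ring of
coefficients, since such a ring is Jacobson. Over a finite field it follows by induction on the
dimension, as a `p`-group fixes a nonzero vector.

*Countable quotients.* For a torsion matrix group `G` over `F` take the normal subgroup `N` of those
`h` for which `h x` and `x` have the same characteristic polynomial for all `x ∈ G`
(`charpolyKernel`). Its elements are unipotent, so `N` is trivial in characteristic zero and a
`p`-group in characteristic `p`; in both cases it is nilpotent. By the Hilbert basis theorem there
are `x₁, …, xₘ ∈ G` such that the coset `g N` is determined by the characteristic polynomials of
`g x₁, …, g xₘ`; these are products of factors `X - ζ` with roots of unity `ζ`, so there are only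
countably many of them and `G / N` is countable.

For countable `ν`, let `Gᵢ` be the part of `G` supported in the first `i` indices and `Nᵢ` its
subgroup just described. As `Nⱼ ≤ Gⱼ ≤ Gᵢ` for `j ≤ i`, and `Gᵢ` normalizes `Nᵢ`, the products
`N₀ ⋯ Nᵢ` are subgroups of `Gᵢ`, and the quotients by `Nᵢ` embed into `Gᵢ / Nᵢ`.
-/

/-! ### Augmentation products of `p`-groups -/

theorem exists_fixed_ne_zero {P : Type*} [Group P] {p : ℕ} [Fact p.Prime] (hP : IsPGroup p P)
    {k V : Type*} [Field k] [AddCommGroup V] [Module k V] [Finite V] [Nontrivial V]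
    (hp : (p : k) = 0) (ρ : P →* Module.End k V) : ∃ v : V, v ≠ 0 ∧ ∀ g, ρ g v = v := by
  let _ : MulAction P V :=
    { smul g v := ρ g v
      one_smul v := by change ρ 1 v = v; simp
      mul_smul g h v := by change ρ (g * h) v = ρ g (ρ h v); simp }
  obtain ⟨w, hw⟩ := exists_ne (0 : V)
  have hpw : p • w = 0 := by rw [← Nat.cast_smul_eq_nsmul k, hp, zero_smul]
  have hdvd : p ∣ Nat.card V := addOrderOf_eq_prime hpw hw ▸ addOrderOf_dvd_natCard w
  have h0 : (0 : V) ∈ MulAction.fixedPoints P V := fun g => map_zero (ρ g)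
  obtain ⟨v, hv, hne⟩ := hP.exists_fixed_point_of_prime_dvd_card_of_fixed_point V hdvd h0
  exact ⟨v, hne.symm, hv⟩

/-- The induction on the dimension: the augmentations `ρ g - 1` of all but the first factor map into
a line of fixed vectors, which the first factor kills. -/
theorem IsPGroup.prod_sub_one_eq_zero_of_finite {P : Type*} [Group P] {p : ℕ} [Fact p.Prime]
    (hP : IsPGroup p P) {k : Type*} [Field k] (hp : (p : k) = 0) (l : List P) :
    ∀ {V : Type*} [AddCommGroup V] [Module k V] [Finite V] (_ : Module.finrank k V ≤ l.length)
      (ρ : P →* Module.End k V), (l.map fun g => ρ g - 1).prod = 0 := by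
  induction l with
  | nil =>
    intro V _ _ _ hl ρ
    have : Subsingleton V := Module.finrank_zero_iff.mp (Nat.le_zero.mp hl)
    exact LinearMap.ext fun _ => Subsingleton.elim _ _
  | cons u l ih =>
    intro V _ _ _ hl ρ
    cases subsingleton_or_nontrivial V
    · exact LinearMap.ext fun _ => Subsingleton.elim _ _
    obtain ⟨v, hv0, hv⟩ := exists_fixed_ne_zero hP hp ρ
    let W : Submodule k V := Submodule.span k {v}
    have hW : ∀ g, ∀ w ∈ W, ρ g w = w := by
      intro g w hw
      obtain ⟨c, rfl⟩ := Submodule.mem_span_singleton.mp hw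
      rw [map_smul, hv]
    have hW' : ∀ g, W ≤ W.comap (ρ g) := fun g w hw => by
      rw [Submodule.mem_comap, hW g w hw]; exact hw
    let σ : P →* Module.End k (V ⧸ W) :=
      { toFun g := W.mapQ W (ρ g) (hW' g)
        map_one' := by ext x; simp
        map_mul' g h := by ext x; simp }
    have hfin : Finite (V ⧸ W) := Finite.of_surjective _ W.mkQ_surjective
    have hrank : Module.finrank k (V ⧸ W) ≤ l.length := by
      have h1 := W.finrank_quotient_add_finrank
      have h2 : Module.finrank k W = 1 := finrank_span_singleton hv0
      simp only [List.length_cons] at hl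
      omega
    have key := ih hrank σ
    have hmk : ∀ (l' : List P) (x : V),
        W.mkQ ((l'.map fun g => ρ g - 1).prod x) = (l'.map fun g => σ g - 1).prod (W.mkQ x) := by
      intro l'
      induction l' with
      | nil => intro x; simp
      | cons g l' ih' =>
        intro x
        simp only [List.map_cons, List.prod_cons, Module.End.mul_apply, ← ih']
        simp [σ]
    ext x
    have hx : (l.map fun g => ρ g - 1).prod x ∈ W := by
      rw [← Submodule.Quotient.mk_eq_zero, ← Submodule.mkQ_apply, hmk, key]; rfl
    simp [hW u _ hx]

/-! ### Finitely generated rings -/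

theorem isJacobsonRing_int : IsJacobsonRing ℤ := by
  refine isJacobsonRing_iff_prime_eq.mpr fun P hP => ?_
  rcases eq_or_ne P ⊥ with rfl | hP0
  · refine le_antisymm (fun x hx => ?_) Ideal.le_jacobson
    have h := Int.isUnit_iff.mp (Ideal.mem_jacobson_bot.mp hx (2 * x))
    have hx0 : x * x = 0 := by
      rcases h with h | h <;> nlinarith [mul_self_nonneg x]
    simpa using hx0
  · have := hP.isMaximal hP0
    exact Ideal.jacobson_eq_self_of_isMaximal

/-- A form of the Nullstellensatz over `ℤ`. -/
theorem finite_of_field_of_finiteType_int (k : Type*) [Field k] [Algebra.FiniteType ℤ k] :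
    Finite k := by
  have := isJacobsonRing_int
  have hfin : Module.Finite ℤ k := finite_of_finite_type_of_isJacobsonRing ℤ k
  obtain ⟨p, hp⟩ := CharP.exists k
  rcases eq_or_ne p 0 with rfl | hp0
  · have : CharZero k := CharP.charP_to_charZero k
    exact absurd (isField_of_isIntegral_of_isField (R := ℤ) (S := k)
      (algebraMap ℤ k).injective_int (Field.toIsField k)) Int.not_isField
  · refine Module.finite_of_fg_torsion k fun x => ⟨⟨(p : ℤ), ?_⟩, ?_⟩
    · exact mem_nonZeroDivisors_of_ne_zero (by exact_mod_cast hp0)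
    · change (p : ℤ) • x = 0
      rw [zsmul_eq_mul, Int.cast_natCast, CharP.cast_eq_zero, zero_mul]

theorem finite_quotient_of_finiteType_int {R : Type*} [CommRing R] [Algebra.FiniteType ℤ R]
    (m : Ideal R) [m.IsMaximal] : Finite (R ⧸ m) :=
  @finite_of_field_of_finiteType_int (R ⧸ m) (Ideal.Quotient.field m)
    (Algebra.FiniteType.of_surjective (RingHom.toIntAlgHom (Ideal.Quotient.mk m))
      Ideal.Quotient.mk_surjective)

/-- As `R` is a Jacobson ring, it is enough to look at the images over its residue fields, which are
finite. -/
theorem IsPGroup.prod_sub_one_eq_zero_of_finiteType {P : Type*} [Group P] {p : ℕ} [Fact p.Prime]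
    (hP : IsPGroup p P) {R n : Type*} [CommRing R] [IsDomain R] [Algebra.FiniteType ℤ R]
    [Fintype n] [DecidableEq n]
    (hp : (p : R) = 0) (ρ : P →* Matrix n n R) (l : List P) (hl : l.length = Fintype.card n) :
    (l.map fun g => ρ g - 1).prod = 0 := by
  have := isJacobsonRing_int
  have hJ : IsJacobsonRing R := isJacobsonRing_of_finiteType (A := ℤ)
  have hbot : (⊥ : Ideal R).jacobson = ⊥ :=
    hJ.out (Ideal.isPrime_bot).isRadical
  ext i j
  rw [Matrix.zero_apply, ← Ideal.mem_bot, ← hbot]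
  refine Ideal.mem_sInf.mpr fun {m} hm => ?_
  have hmax : m.IsMaximal := hm.2
  let _ := Ideal.Quotient.field m
  have := finite_quotient_of_finiteType_int m
  let f : Matrix n n R →+* Module.End (R ⧸ m) (n → R ⧸ m) :=
    (Matrix.toLinAlgEquiv' (R := R ⧸ m) (n := n)).toRingEquiv.toRingHom.comp
      (Ideal.Quotient.mk m).mapMatrix
  have hpm : (p : R ⧸ m) = 0 := by rw [← map_natCast (Ideal.Quotient.mk m), hp, map_zero]
  have h := hP.prod_sub_one_eq_zero_of_finite hpm l (V := n → R ⧸ m) (by simp [hl])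
    ((f : Matrix n n R →* Module.End (R ⧸ m) (n → R ⧸ m)).comp ρ)
  have h2 : f (l.map fun g => ρ g - 1).prod = 0 := by
    rw [map_list_prod, List.map_map, ← h]
    congr 2
    funext g
    simp
  have h3 : (Ideal.Quotient.mk m).mapMatrix (l.map fun g => ρ g - 1).prod = 0 :=
    (Matrix.toLinAlgEquiv' (R := R ⧸ m) (n := n)).injective (h2.trans (map_zero _).symm)
  exact Ideal.Quotient.eq_zero_iff_mem.mp (congrFun (congrFun h3 i) j)

/-- Matrices of a finitely generated group have all their entries in a finitely generated ring,
which can be chosen to contain any given element. -/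
theorem exists_finiteType_lift {G : Type*} [Group G] [Group.FG G] {L n : Type*} [Field L]
    [Fintype n] [DecidableEq n] (ρ : G →* Matrix n n L) (t : L) :
    ∃ R : Subalgebra ℤ L, Algebra.FiniteType ℤ R ∧ t ∈ R ∧
      ∃ ρ' : G →* Matrix n n R, ∀ g, (ρ' g).map R.val = ρ g := by
  classical
  obtain ⟨S, hS⟩ := (Monoid.fg_def (M := G)).mp inferInstance
  let T : Finset L := insert t
    (S.biUnion fun g => Finset.univ.image fun ij : n × n => ρ g ij.1 ij.2)
  let R : Subalgebra ℤ L := Algebra.adjoin ℤ (T : Set L)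
  have hgen : ∀ g ∈ S, ρ g ∈ R.matrix (n := n) := fun g hg i j =>
    Algebra.subset_adjoin <| Finset.mem_insert_of_mem <| Finset.mem_biUnion.mpr
      ⟨g, hg, Finset.mem_image.mpr ⟨(i, j), Finset.mem_univ _, rfl⟩⟩
  have hR : ∀ g, ρ g ∈ R.matrix (n := n) := fun g => by
    have hle : (⊤ : Submonoid G) ≤ (R.matrix (n := n)).toSubmonoid.comap ρ :=
      hS ▸ Submonoid.closure_le.mpr hgen
    exact hle (Submonoid.mem_top g)
  have hinj : Function.Injective (R.val.mapMatrix (m := n)) := fun A B h =>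
    Matrix.map_injective Subtype.val_injective h
  refine ⟨R, ?_, Algebra.subset_adjoin (Finset.mem_insert_self _ _), ?_⟩
  · exact (Subalgebra.fg_iff_finiteType R).mp ⟨T, rfl⟩
  · refine ⟨⟨⟨fun g => Matrix.of fun i j => ⟨ρ g i j, hR g i j⟩, ?_⟩, ?_⟩, fun g => rfl⟩
    · exact hinj ((map_one ρ).trans (map_one R.val.mapMatrix).symm)
    · intro g h
      refine hinj ?_
      rw [map_mul]
      exact map_mul ρ g h

/-- The claim concerns finitely many elements at a time, and the group they generate has its
entries in a finitely generated ring. -/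
theorem IsPGroup.prod_sub_one_eq_zero {P : Type*} [Group P] {p : ℕ} [Fact p.Prime]
    (hP : IsPGroup p P) {L n : Type*} [Field L] [Fintype n] [DecidableEq n]
    (hp : (p : L) = 0) (ρ : P →* Matrix n n L) (l : List P) (hl : l.length = Fintype.card n) :
    (l.map fun g => ρ g - 1).prod = 0 := by
  classical
  let H : Subgroup P := Subgroup.closure (l.toFinset : Set P)
  have hH : Group.FG H := (Group.fg_iff_subgroup_fg H).mpr ⟨_, rfl⟩
  obtain ⟨R, hR, -, ρ', hρ'⟩ := exists_finiteType_lift (ρ.comp H.subtype) 0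
  obtain ⟨l', hl'⟩ : ∃ l' : List H, l'.map H.subtype = l :=
    ⟨l.pmap (fun g hg => ⟨g, hg⟩) fun g hg => Subgroup.subset_closure (by simpa using hg), by
      simp [List.map_pmap]⟩
  have hpR : (p : R) = 0 := Subtype.val_injective (by simpa using hp)
  have h := (hP.to_subgroup H).prod_sub_one_eq_zero_of_finiteType hpR ρ' l' (by
    rw [← hl, ← hl', List.length_map])
  have h2 := congrArg (R.val : R →+* L).mapMatrix h
  rw [map_zero, map_list_prod, List.map_map] at h2
  rw [← h2, ← hl', List.map_map]
  congr 2
  funext g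
  have h3 : (R.val : R →+* L).mapMatrix (ρ' g) = ρ g := hρ' g
  change ρ g - 1 = (R.val : R →+* L).mapMatrix (ρ' g - 1)
  rw [map_sub, map_one, h3]

/-! ### Nilpotency from vanishing augmentation products -/

section Augmentation

variable {G A : Type*} [Group G] [Ring A] (ρ : G →* A)

/-- The additive group generated by the augmentations `ρ g - 1` of a representation `ρ` of a group
by elements of a ring. It is the image of the augmentation ideal of the integral group ring. -/
def augmentation : Submodule ℤ A :=
  Submodule.span ℤ (Set.range fun g => ρ g - 1)

theorem sub_one_mem_augmentation (g : G) : ρ g - 1 ∈ augmentation ρ :=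
  Submodule.subset_span ⟨g, rfl⟩

theorem augmentation_pow_succ_mul_le (k : ℕ) :
    augmentation ρ ^ (k + 1) * augmentation ρ ≤ augmentation ρ ^ (k + 1) := by
  have h1 : augmentation ρ * augmentation ρ ≤ augmentation ρ := by
    rw [augmentation, Submodule.span_mul_span, Submodule.span_le]
    rintro _ ⟨_, ⟨g, rfl⟩, _, ⟨h, rfl⟩, rfl⟩
    have : (ρ g - 1) * (ρ h - 1) = (ρ (g * h) - 1) - (ρ g - 1) - (ρ h - 1) := by
      rw [map_mul]; noncomm_ring
    change (ρ g - 1) * (ρ h - 1) ∈ augmentation ρ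
    rw [this]
    exact sub_mem (sub_mem (sub_one_mem_augmentation ρ _) (sub_one_mem_augmentation ρ _))
      (sub_one_mem_augmentation ρ _)
  rw [pow_succ, mul_assoc]
  gcongr

theorem mul_mem_augmentation_pow {k : ℕ} {a : A} (ha : a ∈ augmentation ρ ^ (k + 1)) (g : G) :
    a * ρ g ∈ augmentation ρ ^ (k + 1) := by
  have : a * ρ g = a * (ρ g - 1) + a := by noncomm_ring
  rw [this]
  exact add_mem (augmentation_pow_succ_mul_le ρ k
    (Submodule.mul_mem_mul ha (sub_one_mem_augmentation ρ g))) ha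

/-- The elements which a representation sends into `1 + I ^ (k + 1)`, where `I` is the image of
the augmentation ideal. -/
def dimensionSubgroup (k : ℕ) : Subgroup G where
  carrier := {g | ρ g - 1 ∈ augmentation ρ ^ (k + 1)}
  one_mem' := by simp
  mul_mem' {g h} hg hh := by
    have : ρ (g * h) - 1 = (ρ g - 1) * ρ h + (ρ h - 1) := by rw [map_mul]; noncomm_ring
    change ρ (g * h) - 1 ∈ augmentation ρ ^ (k + 1)
    rw [this]
    exact add_mem (mul_mem_augmentation_pow ρ hg h) hh
  inv_mem' {g} hg := by
    have : ρ g⁻¹ - 1 = -((ρ g - 1) * ρ g⁻¹) := by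
      rw [sub_mul, ← map_mul, mul_inv_cancel, map_one, one_mul, neg_sub]
    change ρ g⁻¹ - 1 ∈ augmentation ρ ^ (k + 1)
    rw [this]
    exact neg_mem (mul_mem_augmentation_pow ρ hg _)

theorem mem_dimensionSubgroup {k : ℕ} {g : G} :
    g ∈ dimensionSubgroup ρ k ↔ ρ g - 1 ∈ augmentation ρ ^ (k + 1) := Iff.rfl

/-- The dimension subgroups form a descending central series, which is trivial from the `n`-th term
on because `n`-fold products of augmentations vanish. -/
theorem isNilpotent_of_prod_sub_one_eq_zero (hρ : Function.Injective ρ) (n : ℕ)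
    (h : ∀ l : List G, l.length = n → (l.map fun g => ρ g - 1).prod = 0) :
    Group.IsNilpotent G := by
  refine (Subgroup.nilpotent_iff_finite_descending_central_series G).mpr
    ⟨n, dimensionSubgroup ρ, ⟨?_, fun x k hx g => ?_⟩, ?_⟩
  · refine (Subgroup.eq_top_iff' _).mpr fun g => ?_
    simpa [mem_dimensionSubgroup] using sub_one_mem_augmentation ρ g
  · rw [mem_dimensionSubgroup] at hx ⊢
    have hcomm : ρ (x * g * x⁻¹ * g⁻¹) - 1 =
        ((ρ x - 1) * (ρ g - 1) - (ρ g - 1) * (ρ x - 1)) * ρ (g * x)⁻¹ := by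
      have h1 : (ρ x - 1) * (ρ g - 1) - (ρ g - 1) * (ρ x - 1) = ρ (x * g) - ρ (g * x) := by
        rw [map_mul, map_mul]; noncomm_ring
      rw [h1, sub_mul, ← map_mul, ← map_mul, mul_inv_cancel, map_one, mul_inv_rev, ← mul_assoc]
    rw [commutatorElement_def, hcomm]
    refine mul_mem_augmentation_pow ρ (sub_mem ?_ ?_) _
    · rw [pow_succ]
      exact Submodule.mul_mem_mul hx (sub_one_mem_augmentation ρ g)
    · rw [pow_succ']
      exact Submodule.mul_mem_mul (sub_one_mem_augmentation ρ g) hx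
  · have hn : augmentation ρ ^ n = ⊥ := by
      rw [augmentation, Submodule.span_pow, Submodule.span_eq_bot]
      intro a ha
      obtain ⟨f, rfl⟩ := Set.mem_pow.mp ha
      choose e he using fun i => (f i).2
      rw [← h (List.ofFn e) (by simp), List.map_ofFn]
      congr 2
      funext i
      exact (he i).symm
    refine (Subgroup.eq_bot_iff_forall _).mpr fun g hg => hρ ?_
    rw [mem_dimensionSubgroup, pow_succ, hn, Submodule.bot_mul, Submodule.mem_bot] at hg
    rw [map_one]
    exact sub_eq_zero.mp hg

end Augmentation

theorem IsPGroup.isNilpotent_of_linear {P : Type*} [Group P] {p : ℕ} [Fact p.Prime]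
    (hP : IsPGroup p P) {L n : Type*} [Field L] [Fintype n] [DecidableEq n]
    (hp : (p : L) = 0) (ρ : P →* Matrix n n L) (hρ : Function.Injective ρ) :
    Group.IsNilpotent P :=
  isNilpotent_of_prod_sub_one_eq_zero ρ hρ _ (hP.prod_sub_one_eq_zero hp ρ)

/-! ### Finitely generated torsion groups -/

theorem finiteIndex_commutator {G : Type*} [Group G] [Group.FG G] (hG : IsMulTorsion G) :
    (commutator G).FiniteIndex := by
  have hsurj : Function.Surjective (Abelianization.of (G := G)) := QuotientGroup.mk'_surjective _
  have : Group.FG (Abelianization G) := Group.fg_of_surjective hsurj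
  have : Finite (Abelianization G) := CommGroup.finite_of_fg_isMulTorsion _ (hG.of_surjective hsurj)
  exact Subgroup.finiteIndex_iff_finite_quotient.mpr this

/-- Every term of the derived series is finitely generated by Schreier's lemma, so it has a finite
abelianization. -/
theorem finiteIndex_derivedSeries {G : Type*} [Group G] [Group.FG G] (hG : IsMulTorsion G)
    (k : ℕ) : (derivedSeries G k).FiniteIndex := by
  induction k with
  | zero => rw [derivedSeries_zero]; infer_instance
  | succ k ih =>
    have h := finiteIndex_commutator (hG.subgroup (derivedSeries G k))
    rw [derivedSeries_succ, ← Subgroup.map_subtype_commutator]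
    refine ⟨?_⟩
    rw [Subgroup.index_map_subtype]
    exact mul_ne_zero h.index_ne_zero ih.index_ne_zero

theorem finite_of_finiteIndex_bot {G : Type*} [Group G] (h : (⊥ : Subgroup G).FiniteIndex) :
    Finite G :=
  (Subgroup.finite_iff_finite_and_finiteIndex (H := (⊥ : Subgroup G))).mpr ⟨inferInstance, h⟩

theorem finite_of_fg_of_isSolvable {G : Type*} [Group G] [Group.FG G] [Group.IsSolvable G]
    (hG : IsMulTorsion G) : Finite G := by
  obtain ⟨k, hk⟩ := Group.IsSolvable.solvable (G := G)
  exact finite_of_finiteIndex_bot (hk ▸ finiteIndex_derivedSeries hG k)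

/-- A matrix congruent to `1` modulo a prime ideal has no torsion of order outside that ideal. -/
theorem eq_one_of_pow_eq_one_of_map_eq_one {R n : Type*} [CommRing R] [IsDomain R] [Fintype n]
    [DecidableEq n] (m : Ideal R) [m.IsPrime] (A : Matrix n n R)
    (hA : (Ideal.Quotient.mk m).mapMatrix A = 1) {N : ℕ} (hN : (N : R) ∉ m) (h : A ^ N = 1) :
    A = 1 := by
  have hS : (Ideal.Quotient.mk m).mapMatrix (∑ i ∈ Finset.range N, A ^ i) =
      (N : Matrix n n (R ⧸ m)) := by
    simp [map_sum, map_pow, hA]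
  have hdet : (∑ i ∈ Finset.range N, A ^ i).det ≠ 0 := by
    intro h0
    have h1 := congrArg (Ideal.Quotient.mk m) h0
    rw [RingHom.map_det, hS, map_zero] at h1
    rw [← Matrix.diagonal_natCast, Matrix.det_diagonal, Finset.prod_const] at h1
    have h2 : (N : R ⧸ m) = 0 := eq_zero_of_pow_eq_zero h1
    exact hN (Ideal.Quotient.eq_zero_iff_mem.mp (by rwa [map_natCast]))
  have h0 : (A - 1) * ∑ i ∈ Finset.range N, A ^ i = 0 := by rw [mul_geom_sum, h, sub_self]
  have hreg := (Matrix.isRegular_of_isLeftRegular_det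
    (IsRegular.of_ne_zero hdet).left).right
  exact sub_eq_zero.mp (hreg (h0.trans (zero_mul _).symm))

/-- The congruence subgroup of a maximal ideal with residue characteristic `p`. -/
theorem exists_finiteIndex_pow_prime_pow_of_finiteType {G : Type*} [Group G]
    {R n : Type*} [CommRing R] [IsDomain R]
    [Algebra.FiniteType ℤ R] [Fintype n] [DecidableEq n] (ρ : G →* Matrix n n R)
    (hρ : Function.Injective ρ) :
    ∃ p : ℕ, p.Prime ∧ ¬ IsUnit (p : R) ∧ ∃ N : Subgroup G, N.FiniteIndex ∧
      ∀ g ∈ N, IsOfFinOrder g → ∃ a : ℕ, g ^ p ^ a = 1 := by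
  obtain ⟨m, hm⟩ := Ideal.exists_maximal R
  let _ := Ideal.Quotient.field m
  have := finite_quotient_of_finiteType_int m
  obtain ⟨p, hp⟩ := CharP.exists (R ⧸ m)
  have hpp : p.Prime := (CharP.char_is_prime_or_zero (R ⧸ m) p).resolve_right
    (CharP.char_ne_zero_of_finite (R ⧸ m) p)
  have hpm : ∀ N : ℕ, (N : R) ∈ m ↔ p ∣ N := fun N => by
    rw [← Ideal.Quotient.eq_zero_iff_mem, map_natCast, CharP.cast_eq_zero_iff (R ⧸ m) p]
  let f : G →* (Matrix n n (R ⧸ m))ˣ :=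
    (MonoidHom.comp (((Ideal.Quotient.mk m).mapMatrix : Matrix n n R →+* Matrix n n (R ⧸ m)) :
      Matrix n n R →* Matrix n n (R ⧸ m)) ρ).toHomUnits
  refine ⟨p, hpp, fun hu => hm.ne_top (Ideal.eq_top_of_isUnit_mem m ((hpm p).mpr dvd_rfl) hu),
    f.ker, Subgroup.finiteIndex_ker f, fun g hg hfin => ?_⟩
  -- the `p`-part of the order is divided out, and the rest is prime to the residue characteristic
  obtain ⟨a, N, hN, hord⟩ := Nat.exists_eq_pow_mul_and_not_dvd hfin.orderOf_pos.ne' p hpp.ne_one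
  refine ⟨a, hρ ?_⟩
  rw [map_one]
  refine eq_one_of_pow_eq_one_of_map_eq_one m _ ?_ (N := N) (fun h => hN ((hpm N).mp h)) ?_
  · have h1 : f (g ^ p ^ a) = 1 := f.ker.pow_mem hg _
    exact congrArg Units.val h1
  · rw [← map_pow, ← pow_mul, ← hord, pow_orderOf_eq_one, map_one]

/-- Congruence subgroups for a group over a field `L`. The condition `p * t ≠ 1` allows one to avoid
a given prime, by choosing `t` as its inverse, and in positive characteristic `p` has to be the
characteristic. -/
theorem exists_finiteIndex_pow_prime_pow_eq_one {G : Type*} [Group G] [Group.FG G]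
    (hG : IsMulTorsion G) {L n : Type*} [Field L] [Fintype n] [DecidableEq n]
    (ρ : G →* Matrix n n L) (hρ : Function.Injective ρ) (t : L) :
    ∃ p : ℕ, p.Prime ∧ (p : L) * t ≠ 1 ∧ (∀ q : ℕ, q.Prime → (q : L) = 0 → q = p) ∧
      ∃ N : Subgroup G, N.FiniteIndex ∧ ∀ g ∈ N, ∃ a : ℕ, g ^ p ^ a = 1 := by
  obtain ⟨R, hR, ht, ρ', hρ'⟩ := exists_finiteType_lift ρ t
  have hinj : Function.Injective ρ' := fun g h hgh => hρ (by rw [← hρ', ← hρ', hgh])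
  obtain ⟨p, hp, hu, N, hN, hNp⟩ := exists_finiteIndex_pow_prime_pow_of_finiteType ρ' hinj
  refine ⟨p, hp, fun h => hu ?_, fun q hq hq0 => ?_, N, hN, fun g hg => hNp g hg (hG g)⟩
  · exact IsUnit.of_mul_eq_one (⟨t, ht⟩ : R) (Subtype.val_injective (by simpa using h))
  · by_contra hqp
    have hq0' : (q : R) = 0 := Subtype.val_injective (by simpa using hq0)
    have hc := ((Nat.coprime_primes hq hp).mpr hqp).cast (R := R)
    rw [hq0'] at hc
    exact hu (isCoprime_zero_left.mp hc)

/-- **Schur's theorem**: torsion matrix groups over a field are locally finite. -/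
theorem finite_of_fg_torsion_linear {G : Type*} [Group G] [Group.FG G] (hG : IsMulTorsion G)
    {L n : Type*} [Field L] [Fintype n] [DecidableEq n] (ρ : G →* Matrix n n L)
    (hρ : Function.Injective ρ) : Finite G := by
  obtain ⟨p, hp, -, hchar, N, hN, hNp⟩ := exists_finiteIndex_pow_prime_pow_eq_one hG ρ hρ 0
  obtain ⟨c, hc⟩ := CharP.exists L
  rcases CharP.char_is_prime_or_zero L c with hcp | rfl
  · obtain rfl := hchar c hcp (CharP.cast_eq_zero L c)
    have : Fact c.Prime := ⟨hcp⟩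
    have hP : IsPGroup c N := fun g => by
      obtain ⟨a, ha⟩ := hNp g g.2
      exact ⟨a, Subtype.val_injective ha⟩
    have : Group.IsNilpotent N := hP.isNilpotent_of_linear (CharP.cast_eq_zero L c)
      (ρ.comp N.subtype) (hρ.comp N.subtype_injective)
    have : Finite N := finite_of_fg_of_isSolvable (hG.subgroup N)
    exact (Subgroup.finite_iff_finite_and_finiteIndex (H := N)).mpr ⟨this, hN⟩
  · have : CharZero L := CharP.charP_to_charZero L
    -- inverting `p` in the ring of coefficients yields a second prime
    obtain ⟨q, hq, hqt, -, M, hM, hMq⟩ :=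
      exists_finiteIndex_pow_prime_pow_eq_one hG ρ hρ ((p : L)⁻¹)
    have hpq : p ≠ q := by
      rintro rfl
      exact hqt (mul_inv_cancel₀ (Nat.cast_ne_zero.mpr hp.ne_zero))
    have hbot : N ⊓ M = ⊥ := (Subgroup.eq_bot_iff_forall _).mpr fun g hg => by
      obtain ⟨a, ha⟩ := hNp g hg.1
      obtain ⟨b, hb⟩ := hMq g hg.2
      have hcop : Nat.Coprime (p ^ a) (q ^ b) :=
        Nat.Coprime.pow a b ((Nat.coprime_primes hp hq).mpr hpq)
      exact orderOf_eq_one_iff.mp (Nat.eq_one_of_dvd_coprimes hcop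
        (orderOf_dvd_of_pow_eq_one ha) (orderOf_dvd_of_pow_eq_one hb))
    exact finite_of_finiteIndex_bot (hbot ▸ inferInstance)

/-! ### Countable quotients of torsion matrix groups -/

section CharpolyKernel

open Polynomial

variable {G L n : Type*} [Group G] [Field L] [Fintype n] [DecidableEq n]

/-- The elements of a matrix group by which any element of the group can be multiplied without
changing its characteristic polynomial. -/
def charpolyKernel (ρ : G →* Matrix n n L) : Subgroup G where
  carrier := {h | ∀ x, (ρ (h * x)).charpoly = (ρ x).charpoly}
  one_mem' x := by rw [one_mul]
  mul_mem' {g h} hg hh x := by rw [mul_assoc, hg, hh]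
  inv_mem' {h} hh x := by rw [← hh (h⁻¹ * x), mul_inv_cancel_left]

theorem charpoly_map_mul_comm (ρ : G →* Matrix n n L) (x y : G) :
    (ρ (x * y)).charpoly = (ρ (y * x)).charpoly := by
  rw [map_mul, map_mul, Matrix.charpoly_mul_comm]

instance charpolyKernel_normal (ρ : G →* Matrix n n L) : (charpolyKernel ρ).Normal where
  conj_mem h hh y x := by
    rw [mul_assoc, mul_assoc, charpoly_map_mul_comm, mul_assoc, mul_assoc, hh,
      charpoly_map_mul_comm]
    group

/-- The elements of the charpoly kernel are unipotent: they have the characteristic polynomial of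
`1`. -/
theorem sub_one_pow_eq_zero_of_mem_charpolyKernel (ρ : G →* Matrix n n L) {h : G}
    (hh : h ∈ charpolyKernel ρ) : (ρ h - 1) ^ Fintype.card n = 0 := by
  have h1 : (ρ h).charpoly = (X - 1) ^ Fintype.card n := by
    rw [← mul_one h, hh 1, map_one, Matrix.charpoly_one]
  have h2 := Matrix.aeval_self_charpoly (ρ h)
  rw [h1] at h2
  simpa using h2

theorem isPGroup_charpolyKernel {p : ℕ} [Fact p.Prime] [CharP L p] (ρ : G →* Matrix n n L)
    (hρ : Function.Injective ρ) : IsPGroup p (charpolyKernel ρ) := by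
  intro h
  cases isEmpty_or_nonempty n
  · exact ⟨0, Subtype.val_injective (hρ (Subsingleton.elim _ _))⟩
  obtain ⟨a, ha⟩ := pow_unbounded_of_one_lt (Fintype.card n) (Fact.out : p.Prime).one_lt
  refine ⟨a, Subtype.val_injective (hρ (sub_eq_zero.mp ?_))⟩
  rw [Subgroup.coe_pow, Subgroup.coe_one, map_pow, map_one, ← one_pow (p ^ a),
    ← sub_pow_char_pow_of_commute p a (Commute.one_right _)]
  exact pow_eq_zero_of_le ha.le (sub_one_pow_eq_zero_of_mem_charpolyKernel ρ h.2)

theorem charpolyKernel_eq_bot [CharZero L] (ρ : G →* Matrix n n L)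
    (hρ : Function.Injective ρ) (hG : IsMulTorsion G) : charpolyKernel ρ = ⊥ := by
  refine (Subgroup.eq_bot_iff_forall _).mpr fun h hh => hρ ?_
  obtain ⟨N, hN, hpow⟩ := (hG h).exists_pow_eq_one
  set A := ρ h with hA
  have hAN : A ^ N = 1 := by rw [hA, ← map_pow, hpow, map_one]
  have hnil : IsNilpotent (A - 1) := ⟨_, sub_one_pow_eq_zero_of_mem_charpolyKernel ρ hh⟩
  let B := ∑ i ∈ Finset.range N, ∑ j ∈ Finset.range i, A ^ j
  have hS : ∑ i ∈ Finset.range N, A ^ i = (N : Matrix n n L) + B * (A - 1) := by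
    rw [Finset.sum_mul]
    simp [geom_sum_mul, Finset.sum_sub_distrib]
  have hcomm : Commute B (A - 1) := by
    refine Commute.sub_right ?_ (Commute.one_right _)
    exact Commute.sum_left _ _ _ fun i _ => Commute.sum_left _ _ _ fun j _ =>
      Commute.pow_left (Commute.refl A) j
  have hN0 : (N : L) ≠ 0 := Nat.cast_ne_zero.mpr hN.ne'
  have hNu : IsUnit (N : Matrix n n L) := by
    have := (IsUnit.mk0 _ hN0).map (algebraMap L (Matrix n n L))
    rwa [map_natCast] at this
  -- the geometric sum differs from the invertible scalar `N` by a nilpotent matrix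
  have hSu : IsUnit (∑ i ∈ Finset.range N, A ^ i) := by
    rw [hS]
    exact IsNilpotent.isUnit_add_left_of_commute (hcomm.isNilpotent_mul_left hnil) hNu
      (Nat.cast_commute N _).symm
  have h0 : (A - 1) * ∑ i ∈ Finset.range N, A ^ i = 0 := by rw [mul_geom_sum, hAN, sub_self]
  rw [map_one]
  exact sub_eq_zero.mp (hSu.mul_left_eq_zero.mp h0)

theorem isNilpotent_charpolyKernel (ρ : G →* Matrix n n L)
    (hρ : Function.Injective ρ) (hG : IsMulTorsion G) : Group.IsNilpotent (charpolyKernel ρ) := by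
  obtain ⟨c, hc⟩ := CharP.exists L
  rcases CharP.char_is_prime_or_zero L c with hcp | rfl
  · have : Fact c.Prime := ⟨hcp⟩
    exact (isPGroup_charpolyKernel ρ hρ).isNilpotent_of_linear (CharP.cast_eq_zero L c)
      (ρ.comp (charpolyKernel ρ).subtype) (hρ.comp (charpolyKernel ρ).subtype_injective)
  · have : CharZero L := CharP.charP_to_charZero L
    rw [charpolyKernel_eq_bot ρ hρ hG]
    infer_instance

/-- The condition that `g * x` and `g' * x` have equal characteristic polynomials consists of
polynomial equations in the entries of `g` and `g'`, one set for each `x`; by the Hilbert basis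
theorem those of finitely many `x` imply all others. -/
theorem exists_finset_charpoly (ρ : G →* Matrix n n L) :
    ∃ T : Finset G, ∀ g g', (∀ x ∈ T, (ρ (g * x)).charpoly = (ρ (g' * x)).charpoly) →
      ∀ x, (ρ (g * x)).charpoly = (ρ (g' * x)).charpoly := by
  classical
  -- `Y` and `Y'` are two generic matrices, and `ev g g'` specializes them to `ρ g` and `ρ g'`
  let A := MvPolynomial (n × n ⊕ n × n) L
  let Y : Matrix n n A := Matrix.of fun i j => MvPolynomial.X (Sum.inl (i, j))
  let Y' : Matrix n n A := Matrix.of fun i j => MvPolynomial.X (Sum.inr (i, j))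
  let D : G → A[X] := fun x => (Y * (ρ x).map MvPolynomial.C).charpoly -
    (Y' * (ρ x).map MvPolynomial.C).charpoly
  let ev : G → G → A →+* L := fun g g' =>
    MvPolynomial.eval (Sum.elim (fun ij => ρ g ij.1 ij.2) fun ij => ρ g' ij.1 ij.2)
  have hev : ∀ g g' x, (D x).map (ev g g') = (ρ (g * x)).charpoly - (ρ (g' * x)).charpoly := by
    intro g g' x
    have h1 : (ev g g').mapMatrix (Y * (ρ x).map MvPolynomial.C) = ρ (g * x) := by
      rw [map_mul, map_mul]
      congr 1
      · ext i j; exact MvPolynomial.eval_X _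
      · ext i j; exact MvPolynomial.eval_C _
    have h2 : (ev g g').mapMatrix (Y' * (ρ x).map MvPolynomial.C) = ρ (g' * x) := by
      rw [map_mul, map_mul]
      congr 1
      · ext i j; exact MvPolynomial.eval_X _
      · ext i j; exact MvPolynomial.eval_C _
    rw [← h1, ← h2, RingHom.mapMatrix_apply, RingHom.mapMatrix_apply, Matrix.charpoly_map,
      Matrix.charpoly_map, ← Polynomial.map_sub]
  let s : Set A := ⋃ x, Set.range (D x).coeff
  obtain ⟨s', hs', hspan⟩ := (Submodule.fg_span_iff_fg_span_finset_subset s).mp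
    (IsNoetherian.noetherian (Ideal.span s))
  choose e he using fun a : s' => Set.mem_iUnion.mp (hs' a.2)
  refine ⟨Finset.univ.image e, fun g g' h x => ?_⟩
  have hker : Ideal.span s ≤ RingHom.ker (ev g g') := by
    change Submodule.span A s ≤ _
    rw [hspan, Submodule.span_le]
    intro a ha
    obtain ⟨k, hk⟩ := he ⟨a, ha⟩
    have h1 := hev g g' (e ⟨a, ha⟩)
    rw [sub_eq_zero.mpr (h _ (Finset.mem_image_of_mem e (Finset.mem_univ _)))] at h1
    have h2 := congrArg (fun q => q.coeff k) h1
    simp only [Polynomial.coeff_map, hk, Polynomial.coeff_zero] at h2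
    exact h2
  rw [← sub_eq_zero, ← hev]
  ext k
  rw [Polynomial.coeff_map, Polynomial.coeff_zero]
  exact hker (Ideal.subset_span (Set.mem_iUnion.mpr ⟨x, k, rfl⟩))

/-- The eigenvalues of torsion matrices are roots of unity. -/
theorem countable_range_charpoly [IsAlgClosed L] (ρ : G →* Matrix n n L) (hG : IsMulTorsion G) :
    (Set.range fun g => (ρ g).charpoly).Countable := by
  -- the roots of unity
  let C : Set L := {r | ∃ N : ℕ, 0 < N ∧ r ^ N = 1}
  have hC : C.Countable := by
    have : C = ⋃ N : {N : ℕ // 0 < N}, {r | r ^ (N : ℕ) = 1} := by ext; simp [C]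
    rw [this]
    refine Set.countable_iUnion fun N => Set.Finite.countable ?_
    have := (nthRootsFinset N.1 (1 : L)).finite_toSet
    refine this.subset fun r hr => by simpa [mem_nthRootsFinset N.2] using hr
  have := hC.to_subtype
  refine (Set.countable_range fun s : Multiset C =>
    (s.map fun r : C => X - Polynomial.C (r : L)).prod).mono ?_
  rintro _ ⟨g, rfl⟩
  obtain ⟨N, hN, hpow⟩ := (hG g).exists_pow_eq_one
  have hroots : ∀ r ∈ (ρ g).charpoly.roots, r ∈ C := by
    intro r hr
    refine ⟨N, hN, ?_⟩
    have h1 := Matrix.mem_spectrum_of_isRoot_charpoly (isRoot_of_mem_roots hr)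
    have h2 := spectrum.pow_mem_pow (ρ g) N h1
    rw [← map_pow, hpow, map_one] at h2
    cases isEmpty_or_nonempty n
    · exact absurd h2 (by simp)
    · simpa [spectrum.one_eq] using h2
  have hsplit : (ρ g).charpoly = ((ρ g).charpoly.roots.map fun r => X - Polynomial.C r).prod :=
    (IsAlgClosed.splits _).eq_prod_roots_of_monic (Matrix.charpoly_monic _)
  generalize (ρ g).charpoly.roots = m at hroots hsplit
  lift m to Multiset C using hroots
  refine ⟨m, ?_⟩
  simp only [hsplit, Multiset.map_map]
  rfl

theorem countable_quotient_charpolyKernel [IsAlgClosed L] (ρ : G →* Matrix n n L)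
    (hG : IsMulTorsion G) : Countable (G ⧸ charpolyKernel ρ) := by
  obtain ⟨T, hT⟩ := exists_finset_charpoly ρ
  have hC := (countable_range_charpoly ρ hG).to_subtype
  let f : G ⧸ charpolyKernel ρ → T → Set.range fun g => (ρ g).charpoly :=
    fun q x => ⟨(ρ (q.out * x)).charpoly, _, rfl⟩
  refine Function.Injective.countable (f := f) fun q q' hqq => ?_
  rw [← q.out_eq', ← q'.out_eq']
  refine QuotientGroup.eq.mpr fun x => ?_
  have h := hT q.out q'.out (fun x hx => congrArg Subtype.val (congrFun hqq ⟨x, hx⟩))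
    (x * q.out⁻¹)
  calc (ρ (q.out⁻¹ * q'.out * x)).charpoly = (ρ (q'.out * (x * q.out⁻¹))).charpoly := by
        rw [mul_assoc, charpoly_map_mul_comm, mul_assoc]
    _ = (ρ (q.out * (x * q.out⁻¹))).charpoly := h.symm
    _ = (ρ x).charpoly := by rw [charpoly_map_mul_comm, inv_mul_cancel_right]

end CharpolyKernel

/-! ### The finitary linear group -/

section Finitary

variable {ν K : Type*} [CommRing K]

/-- The finitary matrices which, together with their inverses, have support in `S`. -/
def supportedIn (S : Set ν) : Subgroup (FL ν K) where
  carrier := {g | matSupp g.1.entry ⊆ S ∧ matSupp g⁻¹.1.entry ⊆ S}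
  one_mem' := ⟨matSupp_subset fun _ _ _ => rfl, matSupp_subset fun _ _ _ => rfl⟩
  mul_mem' {g h} hg hh := by
    refine ⟨(matSupp_matMul g.1.finite_supp).trans (Set.union_subset hg.1 hh.1), ?_⟩
    rw [mul_inv_rev]
    exact (matSupp_matMul h⁻¹.1.finite_supp).trans (Set.union_subset hh.2 hg.2)
  inv_mem' {g} hg := ⟨hg.2, by rw [inv_inv]; exact hg.1⟩

theorem supportedIn_mono {S T : Set ν} (h : S ⊆ T) :
    supportedIn (K := K) S ≤ supportedIn T := fun _ hg => ⟨hg.1.trans h, hg.2.trans h⟩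

theorem exists_mem_supportedIn (g : FL ν K) : ∃ S : Finset ν, g ∈ supportedIn (S : Set ν) := by
  refine ⟨(g.1.finite_supp.union g⁻¹.1.finite_supp).toFinset, ?_⟩
  rw [Set.Finite.coe_toFinset]
  exact ⟨Set.subset_union_left, Set.subset_union_right⟩

/-- Restriction of the matrices supported in a finite set `S` to `S × S`. -/
noncomputable def restrictHom [DecidableEq ν] (S : Finset ν) :
    supportedIn (K := K) (S : Set ν) →* Matrix S S K where
  toFun g := Matrix.of fun i j => g.1.1.entry i j
  map_one' := by
    ext i j
    have hsupp : matSupp (1 : FinitaryMatrix ν K).entry ⊆ ∅ := matSupp_subset fun _ _ _ => rfl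
    refine (matSupp_eq_one fun h => hsupp h.1).trans ?_
    rcases eq_or_ne i j with rfl | h
    · rw [if_pos rfl, Matrix.one_apply_eq]
    · rw [if_neg (Subtype.coe_ne_coe.mpr h), Matrix.one_apply_ne h]
  map_mul' g h := by
    ext i j
    change matMul g.1.1.entry h.1.1.entry i j = _
    rw [matMul_eq_sum _ _ g.2.1 i.2, Matrix.mul_apply, ← Finset.sum_coe_sort]
    rfl

theorem restrictHom_injective [DecidableEq ν] (S : Finset ν) :
    Function.Injective (restrictHom (K := K) S) := by
  intro g h hgh
  refine Subtype.val_injective (Units.ext (FinitaryMatrix.ext' ?_))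
  ext i j
  by_cases hij : i ∈ S ∧ j ∈ S
  · exact congrFun (congrFun hgh ⟨i, hij.1⟩) ⟨j, hij.2⟩
  · rw [matSupp_eq_one fun h' => hij ⟨g.2.1 h'.1, g.2.1 h'.2⟩,
      matSupp_eq_one fun h' => hij ⟨h.2.1 h'.1, h.2.1 h'.2⟩]

theorem exists_faithful_matrix_hom [IsDomain K] {H : Subgroup (FL ν K)} {S : Finset ν}
    [DecidableEq ν] (hH : H ≤ supportedIn (S : Set ν)) :
    ∃ ρ : H →* Matrix S S (AlgebraicClosure (FractionRing K)), Function.Injective ρ := by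
  let F := AlgebraicClosure (FractionRing K)
  let φ : K →+* F := (algebraMap (FractionRing K) F).comp (algebraMap K (FractionRing K))
  have hφ : Function.Injective φ := (algebraMap (FractionRing K) F).injective.comp
    (IsFractionRing.injective K (FractionRing K))
  let r := (restrictHom S).comp (Subgroup.inclusion hH)
  have hr : Function.Injective r :=
    (restrictHom_injective S).comp (Subgroup.inclusion_injective hH)
  refine ⟨MonoidHom.comp ((φ.mapMatrix : Matrix S S K →+* Matrix S S F) :
    Matrix S S K →* Matrix S S F) r, ?_⟩
  exact (Matrix.map_injective hφ).comp hr

theorem finite_of_fg_of_isMulTorsion [IsDomain K] {H : Subgroup (FL ν K)} (hfg : H.FG)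
    (hH : IsMulTorsion H) : Finite H := by
  classical
  obtain ⟨s, rfl⟩ := hfg
  choose S hS using exists_mem_supportedIn (ν := ν) (K := K)
  have hle : Subgroup.closure (s : Set (FL ν K)) ≤
      supportedIn ((s.biUnion S : Finset ν) : Set ν) := by
    refine (Subgroup.closure_le _).mpr fun g hg => ?_
    exact supportedIn_mono (Finset.coe_subset.mpr (Finset.subset_biUnion_of_mem S hg)) (hS g)
  obtain ⟨ρ, hρ⟩ := exists_faithful_matrix_hom hle
  have : Group.FG (Subgroup.closure (s : Set (FL ν K))) :=
    (Group.fg_iff_subgroup_fg _).mpr ⟨s, rfl⟩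
  exact finite_of_fg_torsion_linear hH ρ hρ

theorem exists_isNilpotent_countable_quotient [IsDomain K] {H : Subgroup (FL ν K)} {S : Finset ν}
    (hS : H ≤ supportedIn (S : Set ν)) (hH : IsMulTorsion H) :
    ∃ N : Subgroup (FL ν K), IsNormalIn N H ∧ Group.IsNilpotent N ∧
      Countable (H ⧸ N.subgroupOf H) := by
  classical
  obtain ⟨ρ, hρ⟩ := exists_faithful_matrix_hom hS
  have hcount := countable_quotient_charpolyKernel ρ hH
  have hnil := isNilpotent_charpolyKernel ρ hρ hH
  have hN : ((charpolyKernel ρ).map H.subtype).subgroupOf H = charpolyKernel ρ :=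
    Subgroup.comap_map_eq_self_of_injective H.subtype_injective _
  refine ⟨(charpolyKernel ρ).map H.subtype, ⟨Subgroup.map_subtype_le _, ?_⟩, ?_, ?_⟩
  · rw [hN]; infer_instance
  · let e := (charpolyKernel ρ).equivMapOfInjective H.subtype H.subtype_injective
    exact Group.nilpotent_of_surjective e.toMonoidHom e.surjective
  · rw [hN]; exact hcount

end Finitary

/-! ### Products of subgroups along an ascending chain -/

section PartialProd

variable {Γ : Type*} [Group Γ]

/-- If `N i` is normal in `G i` and the `G i` ascend, then the product `N 0 * ⋯ * N i` is a
subgroup of `G i`. -/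
theorem exists_subgroup_eq_partialProd {G N : ℕ → Subgroup Γ} (hG : Monotone G)
    (hN : ∀ i, IsNormalIn (N i) (G i)) (i : ℕ) :
    ∃ P : Subgroup Γ, (P : Set Γ) = partialProd N i ∧ N i ≤ P ∧ P ≤ G i := by
  induction i with
  | zero => exact ⟨N 0, rfl, le_rfl, (hN 0).1⟩
  | succ i ih =>
    obtain ⟨P, hP, -, hPG⟩ := ih
    have hPG' : P ≤ G (i + 1) := hPG.trans (hG i.le_succ)
    refine ⟨P ⊔ N (i + 1), ?_, le_sup_right, sup_le hPG' (hN (i + 1)).1⟩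
    have hnorm : P ≤ Subgroup.normalizer (N (i + 1)) :=
      hPG'.trans ((Subgroup.normal_subgroupOf_iff_le_normalizer (hN (i + 1)).1).mp (hN (i + 1)).2)
    rw [Subgroup.coe_mul_of_left_le_normalizer_right P (N (i + 1)) hnorm, hP]
    rfl

theorem IsNormalIn.mono {N P H : Subgroup Γ} (h : IsNormalIn N H) (hNP : N ≤ P) (hPH : P ≤ H) :
    IsNormalIn N P :=
  ⟨hNP, (Subgroup.normal_subgroupOf_iff_le_normalizer hNP).mpr
    (hPH.trans ((Subgroup.normal_subgroupOf_iff_le_normalizer h.1).mp h.2))⟩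

theorem countable_quotient_mono {N P H : Subgroup Γ} (hPH : P ≤ H)
    (h : Countable (H ⧸ N.subgroupOf H)) : Countable (P ⧸ N.subgroupOf P) :=
  (Subgroup.quotientSubgroupOfEmbeddingOfLE N hPH).injective.countable

theorem monotone_partialProd (N : ℕ → Subgroup Γ) : Monotone (partialProd N) :=
  monotone_nat_of_le_succ fun i g hg => ⟨g, hg, 1, (N (i + 1)).one_mem, mul_one g⟩

end PartialProd

/-! ### Torsion subgroups of the finitary linear group -/

theorem theorem1 {ν K : Type*} [CommRing K] [IsDomain K]
    (G : Subgroup (FL ν K)) (hG : IsMulTorsion G) :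
    IsLocallyFiniteGroup G ∧
    (Countable ν →
      ∃ Gs Ns : ℕ → Subgroup (FL ν K),
        Monotone Gs ∧
        (G : Set (FL ν K)) = ⋃ i, (Gs i : Set (FL ν K)) ∧
        (∀ i, IsNormalIn (Ns i) (Gs i) ∧ Group.IsNilpotent (Ns i) ∧
          Countable (Gs i ⧸ (Ns i).subgroupOf (Gs i))) ∧
        (∃ P : Subgroup (FL ν K), P ≤ G ∧ (P : Set (FL ν K)) = infiniteProd Ns) ∧
        (∀ i, ∃ P : Subgroup (FL ν K), (P : Set (FL ν K)) = partialProd Ns i ∧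
          IsNormalIn (Ns i) P ∧ Countable (P ⧸ (Ns i).subgroupOf P))) := by
  refine ⟨fun H hH => ?_, fun hν => ?_⟩
  · let e := H.equivMapOfInjective G.subtype G.subtype_injective
    have : Group.FG H := (Group.fg_iff_subgroup_fg H).mpr hH
    have hfg : Group.FG (H.map G.subtype) :=
      Group.fg_of_surjective (f := e.toMonoidHom) e.surjective
    have : Finite (H.map G.subtype) := finite_of_fg_of_isMulTorsion
      ((Group.fg_iff_subgroup_fg _).mp hfg)
      ((hG.subgroup H).of_surjective (f := e.toMonoidHom) e.surjective)
    exact Finite.of_equiv _ e.symm.toEquiv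
  obtain ⟨f, hf⟩ := exists_injective_nat ν
  let S : ℕ → Finset ν := fun i => (Set.Finite.preimage hf.injOn (Set.finite_Iio i)).toFinset
  have hmemS : ∀ k i, k ∈ S i ↔ f k < i := fun k i => by simp [S]
  let Gs : ℕ → Subgroup (FL ν K) := fun i => G ⊓ supportedIn (S i : Set ν)
  have hmono : Monotone Gs := fun i j hij => inf_le_inf_left G <| supportedIn_mono fun k hk =>
    (hmemS k j).mpr (((hmemS k i).mp hk).trans_le hij)
  have htors : ∀ i, IsMulTorsion (Gs i) := fun i g =>
    Submonoid.isOfFinOrder_coe.mp (G.subtype.isOfFinOrder (hG ⟨g, g.2.1⟩))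
  choose Ns hNs using fun i => exists_isNilpotent_countable_quotient
    (inf_le_right : Gs i ≤ supportedIn (S i : Set ν)) (htors i)
  choose P hP hNP hPG using exists_subgroup_eq_partialProd hmono fun i => (hNs i).1
  have hPmono : Monotone P := fun i j hij => by
    rw [← SetLike.coe_subset_coe, hP, hP]
    exact monotone_partialProd Ns hij
  refine ⟨Gs, Ns, hmono, ?_, hNs, ⟨⨆ i, P i, iSup_le fun i => (hPG i).trans inf_le_left, ?_⟩,
    fun i => ⟨P i, hP i, (hNs i).1.mono (hNP i) (hPG i),
      countable_quotient_mono (hPG i) (hNs i).2.2⟩⟩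
  · refine Set.Subset.antisymm (fun g hg => ?_) (Set.iUnion_subset fun i g hg => hg.1)
    obtain ⟨T, hT⟩ := exists_mem_supportedIn g
    refine Set.mem_iUnion.mpr ⟨T.sup f + 1, hg, supportedIn_mono (fun k hk => ?_) hT⟩
    exact (hmemS _ _).mpr (Nat.lt_succ_of_le (Finset.le_sup hk))
  · rw [Subgroup.coe_iSup_of_directed hPmono.directed_le]
    simp only [hP, infiniteProd]
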